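/- Let $\mathbb N=\{1,2,3,\dots\}$. For every countable limit ordinal $\beta$ fix a sequence $(\beta_n)_{n\in\mathbb N}$ of ordinals in $[0,\beta)$ increasing to $\beta$. Define families $\mathrm S_\alpha$ ($\alpha<\omega_1$) of finite subsets of $\mathbb N$ by $\mathrm S_0=\{\{n\}:n\in\mathbb N\}$; $\mathrm S_{\alpha+1}=\big\{\bigcup_{j=1}^nE_j: n\in\mathbb N,\ E_1,\dots,E_n\in\mathrm S_\alpha,\ n\le \min E_1,\ \max E_j<\min E_{j+1}\text{ for }1\le j<n\big\}$; and, for a limit ordinal $\beta$, $\mathrm S_\beta=\{A: \exists n\in\mathbb N,\ n\le\min A\text{ and }A\in\mathrm S_{\beta_n}\}$. Let $c_0$ be the space of real null sequences indexed by $\mathbb N$ with the norm $\|\cdot\|_\infty$ and unit vectors $e_i$, and let $(\mathrm S_\alpha(\mathbb Z),d_\infty)$ be the set $\{\sum_{i\in G}c_ie_i: G\in\mathrm S_\alpha,\ c_i\in\mathbb Z\}\subset c_0$ with the metric induced by $\|\cdot\|_\infty$. For functions $\rho,\omega:[0,\infty)\to[0,\infty)$, a map $f:X\to Y$ between metric spaces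 is a $(\rho,\omega)$-embedding if $\rho(d_X(x,y))\le d_Y(f(x),f(y))\le\omega(d_X(x,y))$ for all $x,y\in X$. A class of metric spaces embeds equi-coarsely into $Y$ if there are non-decreasing $\rho,\omega:[0,\infty)\to[0,\infty)$ with $\lim_{t\to\infty}\rho(t)=\infty$ such that every member of the class admits a $(\rho,\omega)$-embedding into $Y$; a single space embeds coarsely into $Y$ if the class consisting of it alone embeds equi-coarsely. Theorem (in ZFC, without extra set-theoretic axioms). Let $(M,d)$ be a separable metric space such that for every $\alpha<\omega_1$ the metric space $(\mathrm S_\alpha(\mathbb Z),d_\infty)$ embeds coarsely into $(M,d)$. Then the class of all separable bounded metric spaces embeds equi-coarsely into $(M,d)$. More precisely, there exist $m_0\in M$, non-decreasing functions $\rho,\omega:[0,\infty)\to[0,\infty)$ with $\lim_{t\to\infty}\rho(t)=\infty$, and, for every integer $n\ge 0$, a $(\rho,\omega)$-embedding $F_n:\{x\in c_0:\|x\|_\infty\le n\}\to M$ with $F_n(0)=m_0$. -/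

import Mathlib

open scoped NNReal Ordinal ZeroAtInfty

/-- A choice, for every countable limit ordinal `β`, of a sequence `φ β 1 ≤ φ β 2 ≤ …` of ordinals
below `β` which increases to `β`. -/
def IsLimitSequenceChoice (φ : Ordinal.{0} → ℕ+ → Ordinal.{0}) : Prop :=
  ∀ β : Ordinal.{0}, β < ω₁ → Order.IsSuccLimit β →
    Monotone (φ β) ∧ (∀ n, φ β n < β) ∧ ∀ γ < β, ∃ n, γ < φ β n

/-- The Schreier families, as sets of finite subsets of `{1, 2, 3, …}`, relative to the sequences
`φ β` approximating the limit ordinals `β`: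
* order `0`: the singletons;
* order `α + 1`: the sets `E₁ ∪ … ∪ Eₙ`, where `n ≥ 1`, all `Eⱼ` are in the family of order `α` and
  `n ≤ E₁ < E₂ < … < Eₙ`;
* limit order `β`: the sets `A` such that, for some `n ≥ 1`, `n ≤ A` and `A` is in the family of
  order `φ β n`. -/
noncomputable def schreier (φ : Ordinal.{0} → ℕ+ → Ordinal.{0}) (α : Ordinal.{0}) :
    Set (Finset ℕ+) :=
  Ordinal.limitRecOn (motive := fun _ => Set (Finset ℕ+)) α
    {A | ∃ n : ℕ+, A = {n}}
    (fun _ S => {A | ∃ (n : ℕ+) (E : Fin (n : ℕ) → Finset ℕ+),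
      (∀ j, E j ∈ S) ∧
      (∀ j, ∀ a ∈ E j, n ≤ a) ∧
      (∀ i j, i < j → ∀ a ∈ E i, ∀ b ∈ E j, a < b) ∧
      A = Finset.univ.biUnion E})
    (fun β _ S => {A | ∃ n : ℕ+, (∀ a ∈ A, n ≤ a) ∧ ∃ h : φ β n < β, A ∈ S (φ β n) h})

/-- The set of all `∑ i ∈ G, c i • e i` with `G ∈ 𝒢` and `c i ∈ E` for `i ∈ G`, where `e i` are the
unit vectors of `c₀ = C₀(ℕ+, ℝ)` (`ℕ+` is discrete). As a subtype of `C₀(ℕ+, ℝ)` it carries the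
metric induced by the supremum norm. -/
def finSuppSpace (𝒢 : Set (Finset ℕ+)) (E : Set ℝ) : Set C₀(ℕ+, ℝ) :=
  {x | ∃ G ∈ 𝒢, (∀ i ∈ G, x i ∈ E) ∧ ∀ i ∉ G, x i = 0}

/-- The integer-valued Schreier metric space of order `α`. -/
def schreierSpace (φ : Ordinal.{0} → ℕ+ → Ordinal.{0}) (α : Ordinal.{0}) : Set C₀(ℕ+, ℝ) :=
  finSuppSpace (schreier φ α) (Set.range ((↑) : ℤ → ℝ))

/-- `ρ, σ : [0,∞) → [0,∞)` are non-decreasing and `ρ t → ∞` as `t → ∞`. -/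
def AreCoarseModuli (ρ σ : ℝ≥0 → ℝ≥0) : Prop :=
  Monotone ρ ∧ Monotone σ ∧ Filter.Tendsto ρ Filter.atTop Filter.atTop

/-- `ρ (d x y) ≤ d (f x) (f y) ≤ σ (d x y)` for all `x` and `y`. -/
def IsModuliEmbedding {X Y : Type*} [MetricSpace X] [MetricSpace Y] (ρ σ : ℝ≥0 → ℝ≥0)
    (f : X → Y) : Prop :=
  ∀ x y, ρ (nndist x y) ≤ nndist (f x) (f y) ∧ nndist (f x) (f y) ≤ σ (nndist x y)

/-- `X` embeds coarsely into `Y`. -/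
def CoarselyEmbeds (X Y : Type*) [MetricSpace X] [MetricSpace Y] : Prop :=
  ∃ ρ σ : ℝ≥0 → ℝ≥0, AreCoarseModuli ρ σ ∧ ∃ f : X → Y, IsModuliEmbedding ρ σ f

/-!
Up to bounded errors, a coarse embedding of the finitely supported integer vectors into `M` takes
values in a countable dense set and has moduli with values in `ℕ`. Look for such an embedding by
fixing, at stage `k`, finitely many of its values, on vectors supported in `{1, …, k}`. For each
`γ < ω₁` the given embedding on a family of finite sets of depth `γ`, applied after relabelling
coordinates, survives for `γ` steps of this game; at each stage there are only countably many
positions, so some position survives for all `γ < ω₁` and it has a successor with the same property.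
An infinite run of the game is a coarse embedding of the integer vectors, which form a net in `c₀`;
hence `c₀` itself embeds coarsely into `M`. Finally every separable metric space embeds coarsely
into `c₀`, with universal moduli, by means of Lipschitz bumps at all integer scales.
-/

universe u

/-- The distances `dist (f a) (f b)` are controlled by the distances `dist (g a) (g b)`, in both
directions and up to integer moduli `w` and `t`. For `g = id` this says that `f` is a coarse
embedding; integer moduli are used because there are only countably many values for them at a given
argument. -/
structure CoarselyControlled {ι X Y : Type*} [PseudoMetricSpace X] [PseudoMetricSpace Y]
    (w t : ℕ → ℕ) (g : ι → X) (f : ι → Y) : Prop where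
  dist_le : ∀ a b (k : ℕ), dist (g a) (g b) ≤ k → dist (f a) (f b) ≤ w k
  le_dist : ∀ a b (k : ℕ), t k ≤ dist (g a) (g b) → k ≤ dist (f a) (f b)

namespace CoarselyControlled

variable {ι κ X Y Z : Type*} [PseudoMetricSpace X] [PseudoMetricSpace Y] [PseudoMetricSpace Z]
  {w t w' t' : ℕ → ℕ} {g : ι → X} {f : ι → Y} {h : ι → Z}

theorem comp (hf : CoarselyControlled w t g f) (r : κ → ι) :
    CoarselyControlled w t (g ∘ r) (f ∘ r) :=
  ⟨fun a b => hf.dist_le (r a) (r b), fun a b => hf.le_dist (r a) (r b)⟩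

theorem trans (hf : CoarselyControlled w t g f) (hh : CoarselyControlled w' t' f h) :
    CoarselyControlled (w' ∘ w) (t ∘ t') g h :=
  ⟨fun a b k hk => hh.dist_le a b _ (hf.dist_le a b k hk),
    fun a b k hk => hh.le_dist a b k (hf.le_dist a b _ hk)⟩

theorem of_dist_le_half {g' : ι → X} (hg : ∀ a, dist (g a) (g' a) ≤ 1 / 2) :
    CoarselyControlled (· + 1) (· + 1) g g' where
  dist_le a b k hk := by
    have := dist_triangle4 (g' a) (g a) (g b) (g' b)
    rw [dist_comm (g' a) (g a)] at this
    push_cast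
    linarith [hg a, hg b]
  le_dist a b k hk := by
    have := dist_triangle4 (g a) (g' a) (g' b) (g b)
    rw [dist_comm (g' b) (g b)] at this
    push_cast at hk
    linarith [hg a, hg b]

end CoarselyControlled

theorem IsModuliEmbedding.exists_coarselyControlled {X Y : Type*} [MetricSpace X] [MetricSpace Y]
    {ρ σ : ℝ≥0 → ℝ≥0} {f : X → Y} (h : AreCoarseModuli ρ σ) (hf : IsModuliEmbedding ρ σ f) :
    ∃ w t, CoarselyControlled w t id f := by
  have hρ (k : ℕ) : ∃ n : ℕ, (k : ℝ≥0) ≤ ρ n :=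
    ((h.2.2.comp tendsto_natCast_atTop_atTop).eventually_ge_atTop _).exists
  choose t ht using hρ
  refine ⟨fun k => ⌈σ k⌉₊, t, fun a b k hk => ?_, fun a b k hk => ?_⟩
  · have hσ : σ (nndist a b) ≤ σ k := h.2.1 hk
    exact_mod_cast ((hf a b).2.trans hσ).trans (Nat.le_ceil _)
  · have hρ : ρ (t k) ≤ ρ (nndist a b) := h.1 (by exact_mod_cast hk)
    exact_mod_cast ((ht k).trans hρ).trans (hf a b).1

/-- The upper modulus of a coarse embedding that is coarsely controlled by `w`. -/
noncomputable def upperModulus (w : ℕ → ℕ) (s : ℝ≥0) : ℝ≥0 :=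
  (partialSups w ⌈s⌉₊ : ℕ)

open Classical in
/-- The lower modulus of a coarse embedding that is coarsely controlled by `t`: the largest `k ≤ s`
with `t k ≤ s`, or `0` if there is none. -/
noncomputable def lowerModulus (t : ℕ → ℕ) (s : ℝ≥0) : ℝ≥0 :=
  (Nat.findGreatest (fun k => (t k : ℝ≥0) ≤ s) ⌊s⌋₊ : ℕ)

theorem areCoarseModuli_lowerModulus_upperModulus (w t : ℕ → ℕ) :
    AreCoarseModuli (lowerModulus t) (upperModulus w) := by
  classical
  have hmono : Monotone (lowerModulus t) := fun r s hrs => Nat.cast_le.2 <|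
    Nat.findGreatest_mono (fun _ hk => hk.trans hrs) (Nat.floor_mono hrs)
  refine ⟨hmono, fun r s hrs => Nat.cast_le.2 ((partialSups w).monotone (Nat.ceil_mono hrs)),
    Filter.tendsto_atTop_atTop_of_monotone hmono fun b => ?_⟩
  set n := max ⌈b⌉₊ (t ⌈b⌉₊) 
  have hb : ⌈b⌉₊ ≤ Nat.findGreatest (fun k => (t k : ℝ≥0) ≤ n) ⌊(n : ℝ≥0)⌋₊ :=
    Nat.le_findGreatest (by rw [Nat.floor_natCast]; exact le_max_left _ _)
      (Nat.cast_le.2 (le_max_right _ _))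
  exact ⟨n, (Nat.le_ceil b).trans (Nat.cast_le.2 hb)⟩

theorem CoarselyControlled.isModuliEmbedding {X Y : Type*} [MetricSpace X] [MetricSpace Y]
    {w t : ℕ → ℕ} {f : X → Y} (hf : CoarselyControlled w t id f) :
    IsModuliEmbedding (lowerModulus t) (upperModulus w) f := by
  classical
  refine fun x y => ⟨?_, ?_⟩
  · rcases eq_or_ne (lowerModulus t (nndist x y)) 0 with h0 | h0
    · exact h0 ▸ zero_le
    · exact hf.le_dist x y _ (Nat.findGreatest_of_ne_zero (P := fun k => (t k : ℝ≥0) ≤ nndist x y)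
        rfl fun h => h0 (by rw [lowerModulus, h, Nat.cast_zero]))
  · have hw : dist (f x) (f y) ≤ w ⌈nndist x y⌉₊ := hf.dist_le x y _ (Nat.le_ceil (nndist x y))
    exact (show nndist (f x) (f y) ≤ w ⌈nndist x y⌉₊ from hw).trans
      (Nat.cast_le.2 (le_partialSups w _))

theorem CoarselyEmbeds.exists_dense_coarselyControlled {X Y : Type*} [MetricSpace X]
    [MetricSpace Y] {S : Set X} (h : CoarselyEmbeds S Y) {q : ℕ → Y} (hq : DenseRange q) :
    ∃ (F : X → ℕ) (w t : ℕ → ℕ),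
      CoarselyControlled w t (Subtype.val : S → X) fun x => q (F x) := by
  obtain ⟨ρ, σ, hρσ, f, hf⟩ := h
  obtain ⟨w, t, hwt⟩ := hf.exists_coarselyControlled hρσ
  choose F hF using fun x => hq.exists_dist_lt (f x) one_half_pos
  have hext (x : S) : Function.extend Subtype.val F 0 x.1 = F x :=
    Subtype.val_injective.extend_apply F 0 x
  have hF' : CoarselyControlled _ _ Subtype.val fun x => q (F x) :=
    CoarselyControlled.trans ⟨hwt.dist_le, hwt.le_dist⟩
      (CoarselyControlled.of_dist_le_half fun x => (hF x).le)
  exact ⟨Function.extend Subtype.val F 0, _, _, by simpa only [hext] using hF'⟩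

theorem exists_forall_lt_omega_one_exists_eq {O C : Type*} [Countable C] (c : O → C)
    {Good : Ordinal.{u} → O → Prop} (hanti : ∀ o, Antitone (Good · o))
    (hGood : ∀ γ < ω₁, ∃ o, Good γ o) :
    ∃ o, Good 0 o ∧ ∀ γ < ω₁, ∃ o', Good γ o' ∧ c o' = c o := by
  suffices ∃ x, ∀ γ < ω₁, ∃ o, Good γ o ∧ c o = x by
    obtain ⟨x, hx⟩ := this
    obtain ⟨o, ho, rfl⟩ := hx 0 (Ordinal.omega_pos 1)
    exact ⟨o, ho, hx⟩
  by_contra! hbad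
  choose γ hγ hγbad using hbad
  obtain ⟨o, ho⟩ := hGood (⨆ x, γ x) (Ordinal.iSup_lt_omega_one hγ)
  exact hγbad (c o) o (hanti o (Ordinal.le_iSup γ _) ho) rfl

theorem exists_seq_of_forall_exists {O : Type*} {P : ℕ → O → Prop} {Q : ℕ → O → O → Prop}
    (hzero : ∃ o, P 0 o) (hsucc : ∀ k o, P k o → ∃ o', P (k + 1) o' ∧ Q k o o') :
    ∃ o : ℕ → O, ∀ k, P k (o k) ∧ Q k (o k) (o (k + 1)) := by
  obtain ⟨o₀, ho₀⟩ := hzero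
  choose next hP hQ using hsucc
  let o (k : ℕ) : {o // P k o} := Nat.rec ⟨o₀, ho₀⟩ (fun k o => ⟨next k o.1 o.2, hP k o.1 o.2⟩) k
  exact ⟨fun k => (o k).1, fun k => ⟨(o k).2, hQ k _ (o k).2⟩⟩

theorem exists_seq_forall_eventuallyConst {O I C : Type*} [Countable I] [Countable C]
    (val : O → I → C) {Good : Ordinal.{u} → ℕ → O → Prop}
    (hanti : ∀ k o, Antitone (Good · k o)) {D : ℕ → Set I}
    (hD : ∀ i, ∀ᶠ k in Filter.atTop, i ∈ D k) (hzero : ∀ γ < ω₁, ∃ o, Good γ 0 o)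
    (hsucc : ∀ γ k o, Good (γ + 1) k o → ∃ o', Good γ (k + 1) o' ∧ (D k).EqOn (val o') (val o)) :
    ∃ o : ℕ → O, (∀ k, Good 0 k (o k)) ∧
      ∀ i, Filter.EventuallyConst (fun k => val (o k) i) Filter.atTop := by
  obtain ⟨e, he⟩ := exists_injective_nat I
  let B (k : ℕ) : Set I := {i | i ∈ D k ∧ e i < k}
  have hB (k : ℕ) : Finite (B k) :=
    (((Set.finite_Iio k).preimage he.injOn).subset fun _ hi => hi.2).to_subtype
  -- Robust objects extend to robust objects: `γ + 1 < ω₁` makes room for one more step, and the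
  -- pigeonhole principle applies because there are only countably many restrictions to `B (k + 1)`.
  let Robust (k : ℕ) (o : O) : Prop :=
    Good 0 k o ∧
      ∀ γ < ω₁, ∃ o', Good γ k o' ∧ (B k).domRestrict (val o') = (B k).domRestrict (val o)
  have hrobust_zero : ∃ o, Robust 0 o :=
    exists_forall_lt_omega_one_exists_eq (fun o => (B 0).domRestrict (val o)) (hanti 0) hzero
  have hrobust_succ (k : ℕ) (o : O) (ho : Robust k o) :
      ∃ o', Robust (k + 1) o' ∧ (B k).EqOn (val o') (val o) := by
    have hext (γ : Ordinal.{u}) (hγ : γ < ω₁) :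
        ∃ o', Good γ (k + 1) o' ∧ (B k).EqOn (val o') (val o) := by
      obtain ⟨o₁, ho₁, hval₁⟩ := ho.2 (γ + 1) ((Cardinal.isSuccLimit_omega 1).add_one_lt hγ)
      obtain ⟨o₂, ho₂, hval₂⟩ := hsucc γ k o₁ ho₁
      exact ⟨o₂, ho₂, fun i hi =>
        (hval₂ hi.1).trans (Set.domRestrict_eq_domRestrict_iff.1 hval₁ hi)⟩
    obtain ⟨o', ⟨hGood, hval⟩, hpigeon⟩ := exists_forall_lt_omega_one_exists_eq
      (fun o => (B (k + 1)).domRestrict (val o))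
      (fun o' _ _ hle h => ⟨hanti (k + 1) o' hle h.1, h.2⟩) hext
    refine ⟨o', ⟨hGood, fun γ hγ => ?_⟩, hval⟩
    obtain ⟨o'', ho'', hval''⟩ := hpigeon γ hγ
    exact ⟨o'', ho''.1, hval''⟩
  obtain ⟨o, ho⟩ := exists_seq_of_forall_exists hrobust_zero hrobust_succ
  refine ⟨o, fun k => (ho k).1.1, fun i => Filter.eventuallyConst_atTop_nat.2 ?_⟩
  have hi : ∀ᶠ k in Filter.atTop, i ∈ B k := (hD i).and (Filter.eventually_gt_atTop (e i))
  obtain ⟨N, hN⟩ := Filter.eventually_atTop.1 hi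
  exact ⟨N, fun k hk => (ho k).2 (hN k hk)⟩

section Depth

variable {ι : Type*} [DecidableEq ι] {𝒢 ℋ : Set (Finset ι)} {A : Finset ι} {γ δ : Ordinal.{u}}
  {i : ι}

/-- `A` has depth at least `γ` in the tree of all finite subsets of members of `𝒢`, in which the
successors of a set are obtained by inserting one new element. -/
def HasDepth (𝒢 : Set (Finset ι)) (A : Finset ι) (γ : Ordinal.{u}) : Prop :=
  (∃ G ∈ 𝒢, A ⊆ G) ∧ ∀ δ < γ, ∃ i ∉ A, HasDepth 𝒢 (insert i A) δ
termination_by γ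

theorem HasDepth.exists_subset (h : HasDepth 𝒢 A γ) : ∃ G ∈ 𝒢, A ⊆ G := by
  rw [HasDepth] at h
  exact h.1

theorem HasDepth.exists_insert (h : HasDepth 𝒢 A γ) (hδ : δ < γ) :
    ∃ i ∉ A, HasDepth 𝒢 (insert i A) δ := by
  rw [HasDepth] at h
  exact h.2 δ hδ

theorem HasDepth.anti (h : HasDepth 𝒢 A γ) (hδ : δ ≤ γ) : HasDepth 𝒢 A δ := by
  rw [HasDepth]
  exact ⟨h.exists_subset, fun ε hε => h.exists_insert (hε.trans_le hδ)⟩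

theorem HasDepth.mono (h : HasDepth 𝒢 A γ) (hℋ : 𝒢 ⊆ ℋ) : HasDepth ℋ A γ := by
  induction γ using WellFoundedLT.induction generalizing A with
  | ind γ ih =>
    rw [HasDepth]
    refine ⟨h.exists_subset.imp fun G hG => ⟨hℋ hG.1, hG.2⟩, fun δ hδ => ?_⟩
    obtain ⟨i, hi, hdepth⟩ := h.exists_insert hδ
    exact ⟨i, hi, ih δ hδ hdepth⟩

theorem HasDepth.insert_of_forall_mem (h : HasDepth 𝒢 A γ) (hℋ : ∀ G ∈ 𝒢, i ∉ G ∧ insert i G ∈ ℋ) :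
    HasDepth ℋ (insert i A) γ := by
  induction γ using WellFoundedLT.induction generalizing A with
  | ind γ ih =>
    rw [HasDepth]
    refine ⟨?_, fun δ hδ => ?_⟩
    · obtain ⟨G, hG, hAG⟩ := h.exists_subset
      exact ⟨insert i G, (hℋ G hG).2, Finset.insert_subset_insert i hAG⟩
    · obtain ⟨j, hj, hdepth⟩ := h.exists_insert hδ
      obtain ⟨G, hG, hjG⟩ := hdepth.exists_subset
      have hji : j ≠ i := fun hji => (hℋ G hG).1 (hji ▸ hjG (Finset.mem_insert_self j A))
      refine ⟨j, by simp only [Finset.mem_insert, hji, hj, or_self, not_false_eq_true], ?_⟩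
      exact Finset.insert_comm i j A ▸ ih δ hδ hdepth

theorem HasDepth.exists_update {κ : Type*} [DecidableEq κ] {s : κ → ι} {B : Finset κ} {p : κ}
    (h : HasDepth 𝒢 (B.image s) γ) (hδ : δ < γ) (hs : Set.InjOn s B) (hp : p ∉ B) :
    ∃ i, Set.EqOn (Function.update s p i) s B ∧
      Set.InjOn (Function.update s p i) (insert p B : Finset κ) ∧
      HasDepth 𝒢 ((insert p B).image (Function.update s p i)) δ := by
  obtain ⟨i, hi, hdepth⟩ := h.exists_insert hδ
  have heq : Set.EqOn (Function.update s p i) s B := fun j hj =>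
    Function.update_of_ne (ne_of_mem_of_not_mem (Finset.mem_coe.1 hj) hp) i s
  have himage : B.image (Function.update s p i) = B.image s := Finset.image_congr heq
  refine ⟨i, heq, ?_, by rwa [Finset.image_insert, Function.update_self, himage]⟩
  rw [Finset.coe_insert, Set.injOn_insert hp]
  refine ⟨hs.congr heq.symm, ?_⟩
  rwa [← Finset.coe_image, himage, Function.update_self]

end Depth

section Schreier

variable {φ : Ordinal.{0} → ℕ+ → Ordinal.{0}} {α β : Ordinal.{0}} {A E : Finset ℕ+} {i : ℕ+}

theorem mem_schreier_zero : A ∈ schreier φ 0 ↔ ∃ n, A = {n} := by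
  unfold schreier
  rw [Ordinal.limitRecOn_zero]
  rfl

theorem mem_schreier_add_one :
    A ∈ schreier φ (α + 1) ↔ ∃ (n : ℕ+) (E : Fin (n : ℕ) → Finset ℕ+),
      (∀ j, E j ∈ schreier φ α) ∧ (∀ j, ∀ a ∈ E j, n ≤ a) ∧
      (∀ i j, i < j → ∀ a ∈ E i, ∀ b ∈ E j, a < b) ∧ A = Finset.univ.biUnion E := by
  unfold schreier
  rw [Ordinal.limitRecOn_add_one]
  rfl

theorem mem_schreier_limit (hβ : Order.IsSuccLimit β) :
    A ∈ schreier φ β ↔ ∃ n : ℕ+, (∀ a ∈ A, n ≤ a) ∧ φ β n < β ∧ A ∈ schreier φ (φ β n) := by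
  unfold schreier
  rw [Ordinal.limitRecOn_limit _ _ _ _ hβ]
  simp only [Set.mem_ofPred_eq, exists_prop]

theorem schreier_subset_schreier_add_one : schreier φ α ⊆ schreier φ (α + 1) := by
  refine fun A hA => mem_schreier_add_one.2
    ⟨1, fun _ => A, fun _ => hA, fun _ _ _ => one_le, fun i j hij => ?_, ?_⟩
  · exact absurd (Subsingleton.elim (α := Fin 1) i j) hij.ne
  · exact (Finset.singleton_biUnion (a := (0 : Fin 1)) (t := fun _ => A)).symm

theorem singleton_mem_schreier (hφ : IsLimitSequenceChoice φ) (hα : α < ω₁) (i : ℕ+) :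
    {i} ∈ schreier φ α := by
  induction α using Ordinal.limitRecOn with
  | zero => exact mem_schreier_zero.2 ⟨i, rfl⟩
  | add_one α ih => exact schreier_subset_schreier_add_one (ih ((lt_add_one α).trans hα))
  | limit β hβ ih =>
    have hlt := (hφ β hα hβ).2.1 1
    exact (mem_schreier_limit hβ).2 ⟨1, fun _ _ => one_le, hlt, ih _ hlt (hlt.trans hα)⟩

theorem insert_mem_schreier_add_one (hφ : IsLimitSequenceChoice φ) (hα : α < ω₁) (hi : 2 ≤ i)
    (hE : E ∈ schreier φ α) (hiE : ∀ a ∈ E, i < a) : insert i E ∈ schreier φ (α + 1) := by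
  refine mem_schreier_add_one.2 ⟨2, (![{i}, E] : Fin 2 → Finset ℕ+), ?_, ?_, ?_, ?_⟩
  · exact Fin.forall_fin_two.2 ⟨singleton_mem_schreier hφ hα i, hE⟩
  · exact Fin.forall_fin_two.2 ⟨fun a ha => Finset.mem_singleton.1 ha ▸ hi,
      fun a ha => hi.trans (hiE a ha).le⟩
  · have hlt : ∀ a ∈ ({i} : Finset ℕ+), ∀ b ∈ E, a < b :=
      fun a ha => Finset.mem_singleton.1 ha ▸ hiE
    exact Fin.forall_fin_two.2
      ⟨Fin.forall_fin_two.2 ⟨fun h => absurd h (lt_irrefl _), fun _ => hlt⟩,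
        fun j hj => absurd hj (Fin.le_last j).not_gt⟩
  · have hunion : Finset.univ.biUnion (![{i}, E] : Fin 2 → Finset ℕ+) = {i} ∪ E := by
      ext a
      simp only [Finset.mem_biUnion, Finset.mem_univ, true_and, Fin.exists_fin_two,
        Finset.mem_union, Matrix.cons_val_zero, Matrix.cons_val_one]
    exact (Finset.insert_eq i E).trans hunion.symm

/-- The last condition makes room for smaller elements, which the induction on `α` inserts. -/
theorem hasDepth_schreier (hφ : IsLimitSequenceChoice φ) (hα : α < ω₁) (N : ℕ+) :
    HasDepth {E ∈ schreier φ α | ∀ a ∈ E, N ≤ a} ∅ α := by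
  induction α using Ordinal.limitRecOn generalizing N with
  | zero =>
    rw [HasDepth]
    exact ⟨⟨{N}, ⟨singleton_mem_schreier hφ hα N, by simp⟩, Finset.empty_subset _⟩,
      fun δ hδ => absurd hδ not_lt_zero⟩
  | add_one α ih =>
    have hα' := (lt_add_one α).trans hα
    rw [HasDepth]
    refine ⟨⟨{N}, ⟨singleton_mem_schreier hφ hα N, by simp⟩, Finset.empty_subset _⟩,
      fun δ hδ => ⟨max N 2, Finset.notMem_empty _, ?_⟩⟩
    refine ((ih hα' (max N 2 + 1)).anti (Order.lt_add_one_iff.1 hδ)).insert_of_forall_mem ?_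
    rintro E ⟨hE, hN⟩
    have hlt (a) (ha : a ∈ E) : max N 2 < a := PNat.add_one_le_iff.1 (hN a ha)
    exact ⟨fun h => lt_irrefl _ (hlt _ h),
      insert_mem_schreier_add_one hφ hα' (le_max_right _ _) hE hlt,
      (Finset.forall_mem_insert _ _ _).2 ⟨le_max_left _ _, fun a ha =>
        (le_max_left _ _).trans (hlt a ha).le⟩⟩
  | limit β hβ ih =>
    obtain ⟨-, hlt, hcof⟩ := hφ β hα hβ
    rw [HasDepth]
    refine ⟨⟨{N}, ⟨singleton_mem_schreier hφ hα N, by simp⟩, Finset.empty_subset _⟩,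
      fun δ hδ => ?_⟩
    obtain ⟨n, hn⟩ := hcof δ hδ
    obtain ⟨i, hi, hdepth⟩ := (ih _ (hlt n) ((hlt n).trans hα) (max N n)).exists_insert hn
    refine ⟨i, hi, hdepth.mono ?_⟩
    rintro E ⟨hE, hN⟩
    exact ⟨(mem_schreier_limit hβ).2 ⟨n, fun a ha => (le_max_right _ _).trans (hN a ha), hlt n, hE⟩,
      fun a ha => (le_max_left _ _).trans (hN a ha)⟩

end Schreier

section NullSequences

variable {ι : Type*} [TopologicalSpace ι]

theorem dist_le_iff_forall_abs_apply_sub_le {x y : C₀(ι, ℝ)} {C : ℝ} (hC : 0 ≤ C) :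
    dist x y ≤ C ↔ ∀ i, |x i - y i| ≤ C := by
  rw [← ZeroAtInftyContinuousMap.dist_toBCF_eq_dist, BoundedContinuousFunction.dist_le hC]
  rfl

theorem abs_apply_sub_le_dist (x y : C₀(ι, ℝ)) (i : ι) : |x i - y i| ≤ dist x y :=
  (dist_le_iff_forall_abs_apply_sub_le dist_nonneg).1 le_rfl i

variable [DiscreteTopology ι]

/-- A finitely supported real function as an element of `c₀`. -/
def finsuppVector (v : ι →₀ ℝ) : C₀(ι, ℝ) where
  toFun := v
  continuous_toFun := continuous_of_discreteTopology
  zero_at_infty' := by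
    rw [Filter.cocompact_eq_cofinite]
    exact tendsto_nhds_of_eventually_eq (Filter.eventually_cofinite.2 v.hasFiniteSupport)

theorem finsuppVector_apply (v : ι →₀ ℝ) (i : ι) : finsuppVector v i = v i := rfl

/-- A finitely supported integer function as an element of `c₀`. -/
noncomputable def intVector (v : ι →₀ ℤ) : C₀(ι, ℝ) :=
  finsuppVector (v.mapRange (↑) Int.cast_zero)

theorem intVector_apply (v : ι →₀ ℤ) (i : ι) : intVector v i = v i := rfl

theorem intVector_eq_zero {v : ι →₀ ℤ} {i : ι} (hi : i ∉ v.support) : intVector v i = 0 := by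
  rw [intVector_apply, Finsupp.notMem_support_iff.1 hi, Int.cast_zero]

theorem dist_intVector_mapDomain {κ : Type*} [TopologicalSpace κ] [DiscreteTopology κ] {s : ι → κ}
    {A : Set ι} (hs : A.InjOn s) {v w : ι →₀ ℤ} (hv : ↑v.support ⊆ A) (hw : ↑w.support ⊆ A) :
    dist (intVector (v.mapDomain s)) (intVector (w.mapDomain s)) =
      dist (intVector v) (intVector w) := by
  classical
  have hmap {u : ι →₀ ℤ} (hu : ↑u.support ⊆ A) {i : ι} (hi : i ∈ A) :
      intVector (u.mapDomain s) (s i) = intVector u i :=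
    congrArg Int.cast (Finsupp.mapDomain_apply' A u hu hs hi)
  have hzero {u : ι →₀ ℤ} (hu : ↑u.support ⊆ A) {i : ι} (hi : i ∉ A) : intVector u i = 0 :=
    intVector_eq_zero fun h => hi (hu h)
  have hmap_zero {u : ι →₀ ℤ} (hu : ↑u.support ⊆ A) {j : κ} (hj : j ∉ s '' A) :
      intVector (u.mapDomain s) j = 0 := by
    refine intVector_eq_zero fun h => hj ?_
    obtain ⟨i, hi, rfl⟩ := Finset.mem_image.1 (Finsupp.mapDomain_support h)
    exact ⟨i, hu hi, rfl⟩
  apply le_antisymm <;> rw [dist_le_iff_forall_abs_apply_sub_le dist_nonneg]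
  · intro j
    by_cases hj : j ∈ s '' A
    · obtain ⟨i, hi, rfl⟩ := hj
      rw [hmap hv hi, hmap hw hi]
      exact abs_apply_sub_le_dist _ _ i
    · rw [hmap_zero hv hj, hmap_zero hw hj, sub_zero, abs_zero]
      exact dist_nonneg
  · intro i
    by_cases hi : i ∈ A
    · rw [← hmap hv hi, ← hmap hw hi]
      exact abs_apply_sub_le_dist _ _ (s i)
    · rw [hzero hv hi, hzero hw hi, sub_zero, abs_zero]
      exact dist_nonneg

theorem finite_support_round (x : C₀(ι, ℝ)) : (Function.support fun i => round (x i)).Finite := by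
  have hx : Filter.Tendsto x Filter.cofinite (nhds 0) :=
    Filter.cocompact_eq_cofinite ι ▸ zero_at_infty x
  have hround : ∀ᶠ i in Filter.cofinite, round (x i) = 0 := by
    have hIco : Set.Ico (-(1 / 2)) (1 / 2) ∈ nhds (0 : ℝ) :=
      Ico_mem_nhds (by norm_num) (by norm_num)
    exact (hx.eventually hIco).mono fun i hi => round_eq_zero_iff.2 hi
  exact Filter.eventually_cofinite.1 hround

/-- The integer vector obtained from an element of `c₀` by rounding its coordinates. -/
noncomputable def roundVector (x : C₀(ι, ℝ)) : ι →₀ ℤ :=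
  Finsupp.ofSupportFinite (fun i => round (x i)) (finite_support_round x)

theorem dist_intVector_roundVector_le (x : C₀(ι, ℝ)) :
    dist (intVector (roundVector x)) x ≤ 1 / 2 := by
  rw [dist_le_iff_forall_abs_apply_sub_le one_half_pos.le]
  intro i
  rw [abs_sub_comm]
  exact abs_sub_round (x i)

end NullSequences

theorem intVector_mem_finSuppSpace {𝒢 : Set (Finset ℕ+)} {v : ℕ+ →₀ ℤ}
    (hv : ∃ G ∈ 𝒢, v.support ⊆ G) : intVector v ∈ finSuppSpace 𝒢 (Set.range ((↑) : ℤ → ℝ)) := by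
  obtain ⟨G, hG, hvG⟩ := hv
  exact ⟨G, hG, fun i _ => ⟨v i, rfl⟩, fun i hi => intVector_eq_zero fun h => hi (hvG h)⟩

theorem Iio_succPNat_add_one (k : ℕ) :
    Finset.Iio (k + 1).succPNat = insert k.succPNat (Finset.Iio k.succPNat) := by
  rw [Finset.Iio_insert, ← Finset.Iio_add_one_eq_Iic]
  rfl

/-- A coarse embedding of the integer vectors supported in members of `family`, with values in the
range of `q` and thus given by a map into `ℕ`, together with a placement of the coordinates, by
which it acts on those integer vectors whose support is placed into a member of `family`. -/
structure PartialEmbedding {M : Type*} [MetricSpace M] (q : ℕ → M) where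
  family : Set (Finset ℕ+)
  toFun : C₀(ℕ+, ℝ) → ℕ
  w : ℕ → ℕ
  t : ℕ → ℕ
  controlled : CoarselyControlled w t
    (Subtype.val : finSuppSpace family (Set.range ((↑) : ℤ → ℝ)) → C₀(ℕ+, ℝ)) fun x => q (toFun x)
  place : ℕ+ → ℕ+

namespace PartialEmbedding

variable {M : Type*} [MetricSpace M] {q : ℕ → M} {P : PartialEmbedding q} {γ : Ordinal.{0}} {k : ℕ}

/-- The first `k` coordinates are placed injectively, onto a set of depth at least `γ`. -/
def HasRank (γ : Ordinal.{0}) (k : ℕ) (P : PartialEmbedding q) : Prop :=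
  Set.InjOn P.place (Finset.Iio k.succPNat) ∧
    HasDepth P.family ((Finset.Iio k.succPNat).image P.place) γ

/-- All the data of a partial embedding that have to converge in the construction of a limit: the
images of the integer vectors and the values of the moduli. -/
noncomputable def value (P : PartialEmbedding q) : (ℕ+ →₀ ℤ) ⊕ ℕ ⊕ ℕ → ℕ :=
  Sum.elim (fun v => P.toFun (intVector (v.mapDomain P.place))) (Sum.elim P.w P.t)

/-- The arguments of `PartialEmbedding.value` that only involve the first `k` coordinates. -/
def stage (k : ℕ) : Set ((ℕ+ →₀ ℤ) ⊕ ℕ ⊕ ℕ) :=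
  {i | ∀ v, i = Sum.inl v → v.support ⊆ Finset.Iio k.succPNat}

theorem eventually_mem_stage (i : (ℕ+ →₀ ℤ) ⊕ ℕ ⊕ ℕ) : ∀ᶠ k in Filter.atTop, i ∈ stage k := by
  rcases i with v | j
  · filter_upwards [Filter.eventually_ge_atTop (v.support.sup (↑))] with k hk u hu i hi
    have hi' : (i : ℕ) ≤ k := (Finset.le_sup (Sum.inl_injective hu ▸ hi)).trans hk
    exact Finset.mem_Iio.2 (PNat.coe_lt_coe _ _ |>.1 (Nat.lt_succ_of_le hi'))
  · exact Filter.Eventually.of_forall fun _ _ h => absurd h Sum.inr_ne_inl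

theorem exists_hasRank_zero (hq : DenseRange q) {𝒢 : Set (Finset ℕ+)} (h𝒢 : HasDepth 𝒢 ∅ γ)
    (hM : CoarselyEmbeds (finSuppSpace 𝒢 (Set.range ((↑) : ℤ → ℝ))) M) :
    ∃ P : PartialEmbedding q, P.HasRank γ 0 := by
  obtain ⟨F, w, t, hF⟩ := hM.exists_dense_coarselyControlled hq
  have hIio : Finset.Iio (Nat.succPNat 0) = ∅ := by decide
  refine ⟨⟨𝒢, F, w, t, hF, id⟩, ?_, ?_⟩
  · rw [hIio, Finset.coe_empty]
    exact Set.injOn_empty id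
  · rwa [hIio, Finset.image_empty]

theorem HasRank.exists_extension (hP : P.HasRank (γ + 1) k) :
    ∃ P' : PartialEmbedding q, P'.HasRank γ (k + 1) ∧ (stage k).EqOn P'.value P.value := by
  obtain ⟨i, heq, hinj, hdepth⟩ :=
    hP.2.exists_update (lt_add_one γ) hP.1 (p := k.succPNat)
      fun h => lt_irrefl _ (Finset.mem_Iio.1 h)
  refine ⟨{ P with place := Function.update P.place k.succPNat i }, ?_, ?_⟩
  · rw [HasRank, Iio_succPNat_add_one]
    exact ⟨hinj, hdepth⟩
  · rintro (v | j) hv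
    · have hmap : v.mapDomain (Function.update P.place k.succPNat i) = v.mapDomain P.place :=
        Finsupp.mapDomain_congr fun j hj => heq (hv v rfl hj)
      exact congrArg (fun u => P.toFun (intVector u)) hmap
    · rfl

theorem HasRank.coarselyControlled (hP : P.HasRank γ k) :
    CoarselyControlled P.w P.t (fun v : {v // Sum.inl v ∈ stage k} => intVector v.1)
      fun v => q (P.value (Sum.inl v.1)) := by
  have hmem (v : {v // Sum.inl v ∈ stage k}) : intVector (v.1.mapDomain P.place) ∈
      finSuppSpace P.family (Set.range ((↑) : ℤ → ℝ)) := by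
    obtain ⟨G, hG, hsub⟩ := hP.2.exists_subset
    exact intVector_mem_finSuppSpace ⟨G, hG, Finsupp.mapDomain_support.trans
      ((Finset.image_subset_image (v.2 v.1 rfl)).trans hsub)⟩
  have hdist (v u : {v // Sum.inl v ∈ stage k}) := dist_intVector_mapDomain hP.1
    (Finset.coe_subset.2 (v.2 v.1 rfl)) (Finset.coe_subset.2 (u.2 u.1 rfl))
  have hcomp := P.controlled.comp fun v => ⟨_, hmem v⟩
  exact ⟨fun v u j hj => hcomp.dist_le v u j ((hdist v u).trans_le hj),
    fun v u j hj => hcomp.le_dist v u j (hj.trans_eq (hdist v u).symm)⟩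

theorem exists_coarselyControlled_intVector {P : ℕ → PartialEmbedding q}
    (hrank : ∀ k, (P k).HasRank 0 k)
    (hconst : ∀ i, Filter.EventuallyConst (fun k => (P k).value i) Filter.atTop) :
    ∃ (w t : ℕ → ℕ) (F : (ℕ+ →₀ ℤ) → M), CoarselyControlled w t intVector F := by
  choose L hL using fun i => Filter.eventuallyConst_iff_exists_eventuallyEq.1 (hconst i)
  have hlimit (i) : ∀ᶠ k in Filter.atTop, i ∈ stage k ∧ (P k).value i = L i :=
    (eventually_mem_stage i).and (hL i)
  refine ⟨fun j => L (Sum.inr (Sum.inl j)), fun j => L (Sum.inr (Sum.inr j)),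
    fun v => q (L (Sum.inl v)), fun a b j hj => ?_, fun a b j hj => ?_⟩
  · obtain ⟨k, ⟨ha, hLa⟩, ⟨hb, hLb⟩, -, hw⟩ := ((hlimit (Sum.inl a)).and
      ((hlimit (Sum.inl b)).and (hlimit (Sum.inr (Sum.inl j))))).exists
    rw [← hLa, ← hLb, ← hw]
    exact (hrank k).coarselyControlled.dist_le ⟨a, ha⟩ ⟨b, hb⟩ j hj
  · obtain ⟨k, ⟨ha, hLa⟩, ⟨hb, hLb⟩, -, ht⟩ := ((hlimit (Sum.inl a)).and
      ((hlimit (Sum.inl b)).and (hlimit (Sum.inr (Sum.inr j))))).exists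
    rw [← ht] at hj
    rw [← hLa, ← hLb]
    exact (hrank k).coarselyControlled.le_dist ⟨a, ha⟩ ⟨b, hb⟩ j hj

end PartialEmbedding

theorem exists_c₀_coarselyControlled_of_forall_hasDepth {M : Type*} [MetricSpace M]
    [TopologicalSpace.SeparableSpace M]
    (hM : ∀ γ : Ordinal.{0}, γ < ω₁ → ∃ 𝒢 : Set (Finset ℕ+), HasDepth 𝒢 ∅ γ ∧
      CoarselyEmbeds (finSuppSpace 𝒢 (Set.range ((↑) : ℤ → ℝ))) M) :
    ∃ (w t : ℕ → ℕ) (F : C₀(ℕ+, ℝ) → M), CoarselyControlled w t id F := by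
  have : Nonempty M := by
    obtain ⟨𝒢, h𝒢, ρ, σ, -, f, -⟩ := hM 0 (Ordinal.omega_pos 1)
    obtain ⟨G, hG, -⟩ := h𝒢.exists_subset
    exact ⟨f ⟨_, intVector_mem_finSuppSpace (v := 0) ⟨G, hG, Finset.empty_subset G⟩⟩⟩
  have hq := TopologicalSpace.denseRange_denseSeq M
  obtain ⟨P, hrank, hconst⟩ := exists_seq_forall_eventuallyConst
    (PartialEmbedding.value (q := TopologicalSpace.denseSeq M)) (Good := PartialEmbedding.HasRank)
    (fun _ _ _ _ hle h => ⟨h.1, h.2.anti hle⟩) PartialEmbedding.eventually_mem_stage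
    (fun γ hγ => let ⟨_, hdepth, hembeds⟩ := hM γ hγ
      PartialEmbedding.exists_hasRank_zero hq hdepth hembeds)
    fun _ _ _ h => h.exists_extension
  obtain ⟨w, t, F, hF⟩ := PartialEmbedding.exists_coarselyControlled_intVector hrank hconst
  exact ⟨_, _, _, (CoarselyControlled.of_dist_le_half fun x =>
    (dist_comm _ _).trans_le (dist_intVector_roundVector_le x)).trans (hF.comp roundVector)⟩

section Bump

variable {X : Type*} [PseudoMetricSpace X] {p : ℕ → X} {s : ℝ} {i : ℕ} {x y : X}

/-- A bump supported in the points closer than `2 * s` to `p (i + 1)` and farther than `s / 2` from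
`p 0, …, p i`. -/
noncomputable def bump (p : ℕ → X) (s : ℝ) (i : ℕ) (x : X) : ℝ :=
  max 0 (min (2 * s - dist x (p (i + 1))) (Metric.infDist x (p '' Set.Iic i) - s / 2))

theorem abs_bump_sub_bump_le (p : ℕ → X) (s : ℝ) (i : ℕ) (x y : X) :
    |bump p s i x - bump p s i y| ≤ dist x y := by
  have hdist : |(2 * s - dist x (p (i + 1))) - (2 * s - dist y (p (i + 1)))| ≤ dist x y := by
    rw [sub_sub_sub_cancel_left, abs_sub_comm]
    exact abs_dist_sub_le x y _
  have hinfDist : |(Metric.infDist x (p '' Set.Iic i) - s / 2) -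
      (Metric.infDist y (p '' Set.Iic i) - s / 2)| ≤ dist x y := by
    rw [sub_sub_sub_cancel_right]
    simpa only [Real.dist_eq, NNReal.coe_one, one_mul] using
      (Metric.lipschitz_infDist_pt (p '' Set.Iic i)).dist_le_mul x y
  refine (abs_max_sub_max_le_max _ _ _ _).trans (max_le ?_ ?_)
  · rw [sub_zero, abs_zero]
    exact dist_nonneg
  · exact (abs_min_sub_min_le_max _ _ _ _).trans (max_le hdist hinfDist)

theorem bump_eq_zero_of_le_dist (h : 2 * s ≤ dist x (p (i + 1))) : bump p s i x = 0 :=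
  max_eq_left ((min_le_left _ _).trans (sub_nonpos.2 h))

theorem bump_eq_zero_of_dist_le {m : ℕ} (hm : m ≤ i) (h : dist x (p m) ≤ s / 2) :
    bump p s i x = 0 := by
  have hinfDist : Metric.infDist x (p '' Set.Iic i) ≤ dist x (p m) :=
    Metric.infDist_le_dist_of_mem (Set.mem_image_of_mem p hm)
  exact max_eq_left ((min_le_right _ _).trans (sub_nonpos.2 (hinfDist.trans h)))

theorem exists_half_le_bump (hp : DenseRange p) (hs : 0 < s) (hx : s ≤ dist x (p 0)) :
    ∃ i, s / 2 ≤ bump p s i x ∧ ∀ y, 3 * s ≤ dist x y → bump p s i y = 0 := by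
  classical
  have hclose : ∃ n, dist x (p n) < s := hp.exists_dist_lt x hs
  obtain ⟨i, hi⟩ : ∃ i, Nat.find hclose = i + 1 :=
    Nat.exists_eq_succ_of_ne_zero fun h0 => hx.not_gt (h0 ▸ Nat.find_spec hclose)
  have hnear : dist x (p (i + 1)) < s := hi ▸ Nat.find_spec hclose
  have hfar : s ≤ Metric.infDist x (p '' Set.Iic i) := by
    refine (Metric.le_infDist (Set.nonempty_Iic.image p)).2 ?_
    rintro _ ⟨m, hm, rfl⟩
    exact not_lt.1 (Nat.find_min hclose (hi ▸ Nat.lt_succ_of_le hm))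
  refine ⟨i, le_max_of_le_right (le_min (by linarith) (by linarith)), fun y hy => ?_⟩
  apply bump_eq_zero_of_le_dist
  linarith [dist_triangle_right x y (p (i + 1)), dist_comm x (p (i + 1))]

theorem exists_half_le_abs_bump_sub_bump (hp : DenseRange p) (hs : 0 < s) (hxy : 3 * s ≤ dist x y) :
    ∃ i, s / 2 ≤ |bump p s i x - bump p s i y| := by
  wlog hx : s ≤ dist x (p 0) generalizing x y
  · have hy : s ≤ dist y (p 0) := by linarith [dist_triangle_right x y (p 0)]
    obtain ⟨i, hi⟩ := this (dist_comm x y ▸ hxy) hy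
    exact ⟨i, abs_sub_comm (bump p s i x) _ ▸ hi⟩
  · obtain ⟨i, hle, hzero⟩ := exists_half_le_bump hp hs hx
    exact ⟨i, by rw [hzero y hxy, sub_zero]; exact hle.trans (le_abs_self _)⟩

theorem finite_setOf_bump_ne_zero (hp : DenseRange p) (x : X) :
    {a : ℕ × ℕ | bump p a.1 a.2 x ≠ 0}.Finite := by
  obtain ⟨m, hm⟩ := hp.exists_dist_lt x one_half_pos
  refine ((Set.finite_Iio ⌈2 * dist x (p 0)⌉₊).prod (Set.finite_Iio m)).subset ?_
  rintro ⟨s, i⟩ (hne : bump p s i x ≠ 0)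
  have hs : s ≠ 0 := by
    rintro rfl
    exact hne (bump_eq_zero_of_le_dist (by simp only [Nat.cast_zero, mul_zero, dist_nonneg]))
  have hs1 : (1 : ℝ) ≤ s := Nat.one_le_cast.2 (Nat.one_le_iff_ne_zero.2 hs)
  refine ⟨Nat.lt_ceil.2 ?_, Set.mem_Iio.2 (lt_of_not_ge fun hmi => ?_)⟩
  · by_contra! h
    exact hne (bump_eq_zero_of_dist_le (Nat.zero_le i) (by linarith))
  · exact hne (bump_eq_zero_of_dist_le hmi (by linarith))

end Bump

theorem exists_coarselyControlled_into_c₀ (X : Type*) [PseudoMetricSpace X]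
    [TopologicalSpace.SeparableSpace X] :
    ∃ f : X → C₀(ℕ+, ℝ), CoarselyControlled id (6 * ·) id f := by
  rcases isEmpty_or_nonempty X with hX | hX
  · exact ⟨hX.elim, fun a => hX.elim a, fun a => hX.elim a⟩
  let p := TopologicalSpace.denseSeq X
  have hp : DenseRange p := TopologicalSpace.denseRange_denseSeq X
  let e : ℕ+ ≃ ℕ × ℕ := Denumerable.equiv₂ _ _
  have hfinite (x : X) : (Function.support fun j => bump p (e j).1 (e j).2 x).Finite :=
    (finite_setOf_bump_ne_zero hp x).preimage e.injective.injOn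
  refine ⟨fun x => finsuppVector (Finsupp.ofSupportFinite _ (hfinite x)),
    fun x y k hk => ?_, fun x y k hk => ?_⟩
  · rw [dist_le_iff_forall_abs_apply_sub_le (Nat.cast_nonneg _)]
    exact fun j => (abs_bump_sub_bump_le p _ _ x y).trans hk
  · rcases k.eq_zero_or_pos with rfl | hk0
    · exact Nat.cast_zero.trans_le dist_nonneg
    obtain ⟨i, hi⟩ := exists_half_le_abs_bump_sub_bump (s := (2 * k : ℕ)) hp
      (Nat.cast_pos.2 (by omega)) (by push_cast at hk ⊢; linarith)
    obtain ⟨j, hj⟩ := e.surjective (2 * k, i)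
    have hcoord := abs_apply_sub_le_dist (finsuppVector (Finsupp.ofSupportFinite _ (hfinite x)))
      (finsuppVector (Finsupp.ofSupportFinite _ (hfinite y))) j
    simp only [finsuppVector_apply, Finsupp.ofSupportFinite_coe, hj] at hcoord
    exact le_trans (by push_cast; linarith) (hi.trans hcoord)

theorem theoremE_general (M : Type*) [MetricSpace M] [TopologicalSpace.SeparableSpace M]
    (hM : ∀ γ : Ordinal.{0}, γ < ω₁ → ∃ 𝒢 : Set (Finset ℕ+), HasDepth 𝒢 ∅ γ ∧
      CoarselyEmbeds (finSuppSpace 𝒢 (Set.range ((↑) : ℤ → ℝ))) M) :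
    (∃ ρ σ : ℝ≥0 → ℝ≥0, AreCoarseModuli ρ σ ∧
      ∀ (X : Type*) [MetricSpace X] [TopologicalSpace.SeparableSpace X],
        ∃ f : X → M, IsModuliEmbedding ρ σ f) ∧
    CoarselyEmbeds C₀(ℕ+, ℝ) M := by
  obtain ⟨w, t, F, hF⟩ := exists_c₀_coarselyControlled_of_forall_hasDepth hM
  refine ⟨⟨_, _, areCoarseModuli_lowerModulus_upperModulus (w ∘ id) ((6 * ·) ∘ t), fun X _ _ => ?_⟩,
    _, _, areCoarseModuli_lowerModulus_upperModulus w t, F, hF.isModuliEmbedding⟩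
  obtain ⟨f, hf⟩ := exists_coarselyControlled_into_c₀ X
  exact ⟨F ∘ f, (hf.trans (hF.comp f)).isModuliEmbedding⟩

theorem theoremE (φ : Ordinal.{0} → ℕ+ → Ordinal.{0}) (hφ : IsLimitSequenceChoice φ)
    (M : Type*) [MetricSpace M] [TopologicalSpace.SeparableSpace M]
    (hM : ∀ α : Ordinal.{0}, α < ω₁ → CoarselyEmbeds (schreierSpace φ α) M) :
    (∃ ρ σ : ℝ≥0 → ℝ≥0, AreCoarseModuli ρ σ ∧
      ∀ (X : Type*) [MetricSpace X] [TopologicalSpace.SeparableSpace X] [BoundedSpace X],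
        ∃ f : X → M, IsModuliEmbedding ρ σ f) ∧
    (∃ (m₀ : M) (ρ σ : ℝ≥0 → ℝ≥0), AreCoarseModuli ρ σ ∧
      ∃ F : (n : ℕ) → Metric.closedBall (0 : C₀(ℕ+, ℝ)) n → M,
        ∀ n : ℕ, IsModuliEmbedding ρ σ (F n) ∧
          F n ⟨0, Metric.mem_closedBall_self n.cast_nonneg⟩ = m₀) := by
  obtain ⟨⟨ρ, σ, h, hX⟩, ρ', σ', h', F, hF⟩ := theoremE_general M fun α hα =>
    ⟨schreier φ α, (hasDepth_schreier hφ hα 1).mono (Set.sep_subset _ _), hM α hα⟩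
  exact ⟨⟨ρ, σ, h, fun X _ _ _ => hX X⟩, F 0, ρ', σ', h', fun n x => F x,
    fun n => ⟨fun x y => hF x y, rfl⟩⟩
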